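/- **Setting.** Clauses are finite sets of literals and CNF formulas are finite sets of clauses over $n$ Boolean variables. *Proofdoors.* Let $F$ be an unsatisfiable CNF formula over $n$ variables and $c,w,s\ge 1$ integers. A *proofdoor* of $F$ with parameters $(c,w,s)$ consists of an integer $k\ge 1$, chunks $A_1,\dots,A_k$ with $F=A_1\wedge\dots\wedge A_k$ (as sets of clauses; chunks may overlap), and CNF formulas $I_1,\dots,I_{k-1}$ such that, with $I_0$ the empty conjunction, 1. for $1\le j<k$, $I_j$ is an interpolant from $I_{j-1}\wedge A_j$ to $A_{j+1}\wedge\dots\wedge A_k$: its variables occur on both sides, $I_{j-1}\wedge A_j\models I_j$, and $I_j\wedge A_{j+1}\wedge\dots\wedge A_k$ is unsatisfiable; 2. each $I_j$ has at most $c$ clauses, and $I_{k-1}$ has at most $s$ clauses; 3. for $1\le j<k$ and every clause $C\in I_j$ there is $S(C)\subseteq I_{j-1}$ with $|S(C)|\le s$ and $A_j\wedge S(C)\models C$; 4. every chunk $A_j$ ($1\le j\le k$) has pathwidth at most $w$, where for each chunk one may use either the graph on the variables that joins two variables occurring in a common clause, or the bipartite graph between variables and clauses. The proofdoor is *small with constant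 $a$* if $c\le a(n+1)$ and $w,s\le a(\lfloor\log_2 n\rfloor+1)$ (with $\lfloor\log_2 0\rfloor:=0$), i.e. $c=O(n)$ and $w,s=O(\log n)$. *Absorption.* A clause database $D$ absorbs a clause $C$ if, for every literal $\ell\in C$, setting all literals of $C$ other than $\ell$ to false makes unit propagation on $D$ force $\ell$ to true or reach a contradiction. *CDCL.* The database initially is $F$. After each restart the solver starts with no variable assigned. While no clause of the database is falsified, it propagates unit clauses as long as there are any (naive BCP), and otherwise decides a freely chosen unassigned variable with a freely chosen value. When a clause is falsified (a conflict) and at least one decision was made, it learns the DECISION clause, which consists of the negations of those decision literals that are ancestors of the conflict in the implication graph; it adds this clause to the database, never deletes a clause, and restarts. A conflict without decisions ends the run: $F$ is refuted. **Theorem (CDCL-Proofdoor Theorem).** For every constant $a$ there is a polynomial $p$ such that the following holds for all $n$ and every CNF formula $F$ over $n$ variables. If $F$ has a proofdoor $(A_1,\dots,A_k;\,I_1,\dots,I_{k-1})$ that is small with constant $a$, then there is a CDCL run of the above kind that refutes $F$ with at most $k\cdot p(n)$ conflicts (hence polynomially many in $n$ if the number $k$ of chunks is polynomial in $n$), and in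 which, for every $1\le j<k$, after at most $j\cdot p(n)$ conflicts all clauses of the interpolant $I_j$ are absorbed by the clause database. -/

import Mathlib

namespace Proofdoor

/-! ### Propositional logic -/

/-- A literal over the variables `Fin n`: `(x, true)` is `x` and `(x, false)` is `¬ x`. -/
abbrev Lit (n : ℕ) := Fin n × Bool

/-- A clause is a finite set of literals, read as their disjunction. -/
abbrev Clause (n : ℕ) := Finset (Lit n)

/-- A CNF formula is a finite set of clauses, read as their conjunction. -/
abbrev CNF (n : ℕ) := Finset (Clause n)

/-- The complementary literal. -/
def Lit.neg {n : ℕ} (l : Lit n) : Lit n := (l.1, !l.2)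

/-- The variables of a clause. -/
def Clause.vars {n : ℕ} (C : Clause n) : Finset (Fin n) := C.image Prod.fst

/-- The variables of a CNF formula. -/
def CNF.vars {n : ℕ} (F : CNF n) : Finset (Fin n) := F.biUnion Clause.vars

/-- The total assignment `σ` satisfies the clause `C`. -/
def SatClause {n : ℕ} (σ : Fin n → Bool) (C : Clause n) : Prop := ∃ l ∈ C, σ l.1 = l.2

/-- The total assignment `σ` satisfies the formula `F`. -/
def SatCNF {n : ℕ} (σ : Fin n → Bool) (F : CNF n) : Prop := ∀ C ∈ F, SatClause σ C

/-- Semantic entailment `F ⊨ G` of CNF formulas. -/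
def Entails {n : ℕ} (F G : CNF n) : Prop := ∀ σ : Fin n → Bool, SatCNF σ F → SatCNF σ G

/-- Unsatisfiability. -/
def Unsat {n : ℕ} (F : CNF n) : Prop := ∀ σ : Fin n → Bool, ¬ SatCNF σ F

/-! ### Pathwidth -/

/-- The sequence of bags `B` is a path decomposition of `G`. -/
structure IsPathDecomposition {V : Type} (G : SimpleGraph V) {m : ℕ} (B : Fin m → Finset V) :
    Prop where
  covers : ∀ v, ∃ i, v ∈ B i
  edges : ∀ u v, G.Adj u v → ∃ i, u ∈ B i ∧ v ∈ B i
  contiguous : ∀ v (i j l : Fin m), i ≤ j → j ≤ l → v ∈ B i → v ∈ B l → v ∈ B j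

/-- The pathwidth of `G` is at most `w`. -/
def PathwidthAtMost {V : Type} (G : SimpleGraph V) (w : ℕ) : Prop :=
  ∃ (m : ℕ) (B : Fin m → Finset V), IsPathDecomposition G B ∧ ∀ i, (B i).card ≤ w + 1

/-- The graph on the variables in which two distinct variables are adjacent iff some clause
contains both. (Variables that do not occur in `A` are isolated, which does not affect the
pathwidth.) -/
def primalGraph {n : ℕ} (A : CNF n) : SimpleGraph (Fin n) :=
  SimpleGraph.fromRel fun x y => ∃ C ∈ A, x ∈ Clause.vars C ∧ y ∈ Clause.vars C

/-- The bipartite graph between variables and clauses in which a variable is adjacent to the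
clauses that contain it. -/
def incidenceGraph {n : ℕ} (A : CNF n) : SimpleGraph (Fin n ⊕ {C : Clause n // C ∈ A}) :=
  SimpleGraph.fromRel fun u v =>
    ∃ (x : Fin n) (C : {C : Clause n // C ∈ A}),
      u = Sum.inl x ∧ v = Sum.inr C ∧ x ∈ Clause.vars C.1

/-- The chunk `A` has pathwidth at most `w`, measured on either of the two graphs. (A bound `w`
for the first graph gives a bound `w + 1` for the second, so the second alternative is the more
general one up to an additive constant.) -/
def CNF.PathwidthAtMost {n : ℕ} (A : CNF n) (w : ℕ) : Prop :=
  Proofdoor.PathwidthAtMost (primalGraph A) w ∨ Proofdoor.PathwidthAtMost (incidenceGraph A) w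

/-! ### Proofdoors -/

/-- `I` is an interpolant for the pair `(A, B)`: a formula over the variables shared by `A` and `B`
that follows from `A` and is inconsistent with `B`. -/
structure IsInterpolant {n : ℕ} (A B I : CNF n) : Prop where
  vars_subset : CNF.vars I ⊆ CNF.vars A ∩ CNF.vars B
  entailed : Entails A I
  refutes : Unsat (I ∪ B)

/-- The conjunction `A_{j+1} ∧ ⋯ ∧ A_k`. -/
def suffix {n : ℕ} (A : ℕ → CNF n) (k j : ℕ) : CNF n := (Finset.Ioc j k).biUnion A

/-- `F = A_1 ∧ ⋯ ∧ A_k` with the interpolants `I_1, …, I_{k-1}` is a proofdoor decomposition of the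
unsatisfiable formula `F`. By convention `I_0` is the empty conjunction. -/
structure IsProofdoorDecomposition {n : ℕ} (F : CNF n) (k : ℕ) (A I : ℕ → CNF n) : Prop where
  unsat : Unsat F
  one_le : 1 ≤ k
  eq_conj : F = suffix A k 0
  init : I 0 = ∅
  interpolant : ∀ j, 1 ≤ j → j < k → IsInterpolant (I (j - 1) ∪ A j) (suffix A k j) (I j)

/-- The decomposition is a proofdoor with parameters `(c, w, s)`. -/
structure IsProofdoor {n : ℕ} (F : CNF n) (k : ℕ) (A I : ℕ → CNF n) (c w s : ℕ) : Prop extends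
    IsProofdoorDecomposition F k A I where
  one_le_c : 1 ≤ c
  one_le_w : 1 ≤ w
  one_le_s : 1 ≤ s
  card_le : ∀ j, 1 ≤ j → j < k → (I j).card ≤ c
  support : ∀ j, 1 ≤ j → j < k → ∀ C ∈ I j, ∃ S ⊆ I (j - 1), S.card ≤ s ∧ Entails (A j ∪ S) {C}
  card_last_le : (I (k - 1)).card ≤ s
  pathwidth_le : ∀ j, 1 ≤ j → j ≤ k → CNF.PathwidthAtMost (A j) w

/-- The parameters are small with constant `a`: `c = O(n)`, `w = O(log n)`, `s = O(log n)`. The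
summands `+ 1` only serve to keep the bounds meaningful for `n = 0, 1`. -/
def SmallParameters (a n c w s : ℕ) : Prop :=
  c ≤ a * (n + 1) ∧ w ≤ a * (Nat.log 2 n + 1) ∧ s ≤ a * (Nat.log 2 n + 1)

/-! ### Unit propagation and absorption -/

/-- The literals forced by unit propagation on `D` after the literals in `α` are set to true. -/
inductive UnitDerives {n : ℕ} (D : CNF n) (α : Set (Lit n)) : Lit n → Prop
  | assumption (l : Lit n) : l ∈ α → UnitDerives D α l
  | unit (R : Clause n) (l : Lit n) : R ∈ D → l ∈ R →
      (∀ m ∈ R, m ≠ l → UnitDerives D α (Lit.neg m)) → UnitDerives D α l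

/-- Unit propagation on `D` from `α` reaches a contradiction: it falsifies a clause of `D`, or makes
two complementary literals true. -/
def UnitConflict {n : ℕ} (D : CNF n) (α : Set (Lit n)) : Prop :=
  (∃ R ∈ D, ∀ m ∈ R, UnitDerives D α (Lit.neg m)) ∨
    ∃ l, UnitDerives D α l ∧ UnitDerives D α (Lit.neg l)

/-- `D` absorbs `C`: whenever all literals of `C` except one literal `l` are set to false, unit
propagation on `D` forces `l` to true (or reaches a contradiction, so that the assignment cannot
be completed at all). -/
def Absorbs {n : ℕ} (D : CNF n) (C : Clause n) : Prop :=
  ∀ l ∈ C, UnitDerives D {m | Lit.neg m ∈ C ∧ Lit.neg m ≠ l} l ∨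
    UnitConflict D {m | Lit.neg m ∈ C ∧ Lit.neg m ≠ l}

/-! ### CDCL -/

/-- The trail of a CDCL solver, most recent entry first. An entry is a literal that was set to true,
together with `none` if it was a decision and `some R` if it was propagated with reason `R`. -/
abbrev Trail (n : ℕ) := List (Lit n × Option (Clause n))

/-- The literal `l` is set to true on the trail. -/
def Trail.IsTrue {n : ℕ} (τ : Trail n) (l : Lit n) : Prop := ∃ r, (l, r) ∈ τ

/-- The literal `l` is set to false on the trail. -/
def Trail.IsFalse {n : ℕ} (τ : Trail n) (l : Lit n) : Prop := Trail.IsTrue τ (Lit.neg l)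

/-- The variable of `l` has no value on the trail. -/
def Trail.Unassigned {n : ℕ} (τ : Trail n) (l : Lit n) : Prop :=
  ¬ Trail.IsTrue τ l ∧ ¬ Trail.IsFalse τ l

/-- The literal `l` was a decision. -/
def Trail.IsDecision {n : ℕ} (τ : Trail n) (l : Lit n) : Prop := (l, none) ∈ τ

/-- The clause `R` is falsified by the trail. -/
def Trail.Falsifies {n : ℕ} (τ : Trail n) (R : Clause n) : Prop := ∀ m ∈ R, Trail.IsFalse τ m

/-- The trail falsifies some clause of the database `D`. -/
def Trail.InConflict {n : ℕ} (τ : Trail n) (D : CNF n) : Prop := ∃ R ∈ D, Trail.Falsifies τ R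

/-- Under the trail, `R` is a unit clause with the only unassigned literal `l`. -/
def Trail.IsUnit {n : ℕ} (τ : Trail n) (R : Clause n) (l : Lit n) : Prop :=
  l ∈ R ∧ Trail.Unassigned τ l ∧ ∀ m ∈ R, m ≠ l → Trail.IsFalse τ m

/-- The trails that the solver can reach with the clause database `D` after a restart. As long as
there is no conflict, unit clauses are propagated (BCP); only when neither a conflict nor a unit
clause is left does the solver decide, choosing the variable and its value freely. -/
inductive Reachable {n : ℕ} (D : CNF n) : Trail n → Prop
  | restart : Reachable D []
  | propagate (τ : Trail n) (R : Clause n) (l : Lit n) : Reachable D τ → ¬ Trail.InConflict τ D →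
      R ∈ D → Trail.IsUnit τ R l → Reachable D ((l, some R) :: τ)
  | decide (τ : Trail n) (l : Lit n) : Reachable D τ → ¬ Trail.InConflict τ D →
      (∀ R ∈ D, ∀ m, ¬ Trail.IsUnit τ R m) → Trail.Unassigned τ l → Reachable D ((l, none) :: τ)

/-- The literals on the trail `τ` that are ancestors, in the implication graph, of the conflict at
the falsified clause `K`. -/
inductive Ancestor {n : ℕ} (τ : Trail n) (K : Clause n) : Lit n → Prop
  | conflict (m : Lit n) : m ∈ K → Ancestor τ K (Lit.neg m)
  | reason (l m : Lit n) (R : Clause n) : Ancestor τ K l → (l, some R) ∈ τ → m ∈ R → m ≠ l →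
      Ancestor τ K (Lit.neg m)

/-- `L` is the clause that the DECISION scheme learns: it consists of the negations of the decision
literals that are ancestors of the conflict. -/
def IsDecisionClause {n : ℕ} (τ : Trail n) (K L : Clause n) : Prop :=
  ∀ m, m ∈ L ↔ Trail.IsDecision τ (Lit.neg m) ∧ Ancestor τ K (Lit.neg m)

/-- One round of the solver: starting from the empty trail it runs into a conflict after at least
one decision, learns the DECISION clause, adds it to the database (from which nothing is ever
deleted), and restarts. -/
def ConflictStep {n : ℕ} (D D' : CNF n) : Prop :=
  ∃ (τ : Trail n) (K L : Clause n), Reachable D τ ∧ K ∈ D ∧ Trail.Falsifies τ K ∧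
    (∃ l, Trail.IsDecision τ l) ∧ IsDecisionClause τ K L ∧ D' = insert L D

/-- The solver runs into a conflict without any decision and reports unsatisfiability. -/
def FinalConflict {n : ℕ} (D : CNF n) : Prop :=
  ∃ τ : Trail n, Reachable D τ ∧ Trail.InConflict τ D ∧ ∀ l, ¬ Trail.IsDecision τ l

/-- A CDCL run that refutes `F` with exactly `T + 1` conflicts: `db t` is the clause database after
the first `t` conflicts, and the last conflict is the one that occurs without decisions. -/
structure IsRefutingRun {n : ℕ} (F : CNF n) (T : ℕ) (db : ℕ → CNF n) : Prop where
  start : db 0 = F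
  step : ∀ t < T, ConflictStep (db t) (db (t + 1))
  final : FinalConflict (db T)

end Proofdoor

/-!
The DECISION scheme lets the solver absorb a clause `K` with a single conflict as soon as unit
propagation refutes the negation of `K`: if `K` is not absorbed, some literal `l ∈ K` is
not forced when the others are set to false, so the solver can decide the negations of the literals
of `K` with that of `l` last, and the learned clause, built from the decisions only, is a subclause
of `K` (`exists_conflictStep`). Since absorbed clauses propagate as if they were in the database, the
solver can follow any resolution derivation, weakening included, at the cost of one
conflict per clause (`unitConflict_of_resolvent`).

It remains to derive a clause `C` from a chunk `A` of pathwidth `w` and a set `S` of at most `s`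
clauses with few resolution steps. Order the variables by the first bag that contains them. For a
set `P` of processed variables and an assignment `σ` that falsifies `C`, consider the clause that
consists of `C` and of the `P`-parts of all the clauses of `A ∪ S` whose `P`-part is falsified by
`σ` (`residual`). When `P` is everything, it contains a clause of `A ∪ S`; when `P` is empty, it is
`C`; and it follows from the two clauses of the same kind for `P ∪ {x}` by resolving on `x`. A clause
of `A` with both processed and unprocessed variables either lies in the current bag or has all its
processed variables there, so apart from weakenings of clauses of `A` there are at most
`2 ^ (w + 1 + s)` such clauses for each `P` (`CNF.PathwidthAtMost.exists_narrowOrder`,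
`card_image_residual_le`). Hence `C` costs at most `n * 2 ^ (w + 1 + s)` conflicts, which is
polynomial in `n` when `w` and `s` are logarithmic. The chunks are processed one after the
other, and the last one yields the empty clause.
-/

namespace Proofdoor

variable {n : ℕ}

/-! ### Unit propagation -/

@[simp] theorem Lit.neg_neg (l : Lit n) : Lit.neg (Lit.neg l) = l := by
  simp [Lit.neg]

theorem Lit.neg_ne (l : Lit n) : Lit.neg l ≠ l := by
  intro h
  have := congrArg Prod.snd h
  simp [Lit.neg] at this

/-- The assignment that makes all literals of `C` false. -/
def negation (C : Clause n) : Set (Lit n) := {m | Lit.neg m ∈ C}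

theorem UnitDerives.mono {D D' : CNF n} {α β : Set (Lit n)} (hD : D ⊆ D') (hα : α ⊆ β)
    {l : Lit n} (h : UnitDerives D α l) : UnitDerives D' β l := by
  induction h with
  | assumption l hl => exact .assumption l (hα hl)
  | unit R l hR hl _ ih => exact .unit R l (hD hR) hl ih

theorem UnitConflict.mono {D D' : CNF n} {α β : Set (Lit n)} (hD : D ⊆ D') (hα : α ⊆ β)
    (h : UnitConflict D α) : UnitConflict D' β := by
  rcases h with ⟨R, hR, h⟩ | ⟨l, h₁, h₂⟩
  · exact .inl ⟨R, hD hR, fun m hm => (h m hm).mono hD hα⟩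
  · exact .inr ⟨l, h₁.mono hD hα, h₂.mono hD hα⟩

/-- Setting further literals to true does not change what is forced if they were forced already. -/
theorem UnitDerives.trans {D : CNF n} {α β : Set (Lit n)} {l : Lit n}
    (h : UnitDerives D β l) (hβ : ∀ m ∈ β, UnitDerives D α m) : UnitDerives D α l := by
  induction h with
  | assumption l hl => exact hβ l hl
  | unit R l hR hl _ ih => exact .unit R l hR hl ih

theorem UnitConflict.trans {D : CNF n} {α β : Set (Lit n)}
    (h : UnitConflict D β) (hβ : ∀ m ∈ β, UnitDerives D α m) : UnitConflict D α := by
  rcases h with ⟨R, hR, h⟩ | ⟨l, h₁, h₂⟩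
  · exact .inl ⟨R, hR, fun m hm => (h m hm).trans hβ⟩
  · exact .inr ⟨l, h₁.trans hβ, h₂.trans hβ⟩

/-- Unit propagation on `D` treats `C` as if it were a clause of `D`. For nonempty `C` this is
absorption; the empty clause, which every database absorbs vacuously, has to be refuted by unit
propagation. -/
def Simulates (D : CNF n) (C : Clause n) : Prop :=
  Absorbs D C ∧ (C = ∅ → UnitConflict D ∅)

theorem Simulates.mono {D D' : CNF n} {C : Clause n} (h : Simulates D C) (hD : D ⊆ D') :
    Simulates D' C :=
  ⟨fun l hl => (h.1 l hl).imp (.mono hD subset_rfl) (.mono hD subset_rfl),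
    fun hC => (h.2 hC).mono hD subset_rfl⟩

theorem Simulates.derives_or_conflict {D : CNF n} {C : Clause n} (h : Simulates D C)
    {α : Set (Lit n)} {l : Lit n} (hl : l ∈ C)
    (hα : ∀ m ∈ C, m ≠ l → UnitDerives D α (Lit.neg m)) :
    UnitDerives D α l ∨ UnitConflict D α := by
  have key : ∀ m ∈ {m | Lit.neg m ∈ C ∧ Lit.neg m ≠ l}, UnitDerives D α m := fun m hm => by
    simpa using hα _ hm.1 hm.2
  exact (h.1 l hl).imp (·.trans key) (·.trans key)

theorem Simulates.conflict {D : CNF n} {C : Clause n} (h : Simulates D C)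
    {α : Set (Lit n)} (hα : ∀ m ∈ C, UnitDerives D α (Lit.neg m)) : UnitConflict D α := by
  rcases C.eq_empty_or_nonempty with hC | ⟨l, hl⟩
  · exact (h.2 hC).mono subset_rfl (Set.empty_subset α)
  · rcases h.derives_or_conflict hl fun m hm _ => hα m hm with h | h
    · exact .inr ⟨l, h, hα l hl⟩
    · exact h

theorem Simulates.weaken {D : CNF n} {C C' : Clause n} (h : Simulates D C) (hC : C ⊆ C') :
    Simulates D C' := by
  refine ⟨fun l hl => ?_, fun h0 => h.2 (Finset.subset_empty.1 (h0 ▸ hC))⟩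
  have key : ∀ m ∈ C, m ≠ l →
      UnitDerives D {m | Lit.neg m ∈ C' ∧ Lit.neg m ≠ l} (Lit.neg m) := fun m hm hml =>
    .assumption _ (by simpa using ⟨hC hm, hml⟩)
  by_cases hlC : l ∈ C
  · exact h.derives_or_conflict hlC key
  · exact .inr (h.conflict fun m hm => key m hm fun e => hlC (e ▸ hm))

theorem Simulates.of_mem {D : CNF n} {C : Clause n} (h : C ∈ D) : Simulates D C := by
  refine ⟨fun l hl => .inl (.unit C l h hl fun m hm hml => .assumption _ ?_), fun h0 => ?_⟩
  · simpa using ⟨hm, hml⟩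
  · exact .inl ⟨C, h, by simp [h0]⟩

theorem unitConflict_of_resolvent {D : CNF n} {K K₀ K₁ : Clause n} {l : Lit n}
    (h₀ : Simulates D K₀) (h₁ : Simulates D K₁)
    (hK₀ : K₀ ⊆ insert l K) (hK₁ : K₁ ⊆ insert (Lit.neg l) K) : UnitConflict D (negation K) := by
  have key : ∀ {K' : Clause n} {x : Lit n}, Simulates D K' → K' ⊆ insert x K →
      UnitDerives D (negation K) x ∨ UnitConflict D (negation K) := by
    intro K' x h hK'
    have hf : ∀ m ∈ K', m ≠ x → UnitDerives D (negation K) (Lit.neg m) := fun m hm hmx =>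
      .assumption _ (by simpa [negation] using (Finset.mem_insert.1 (hK' hm)).resolve_left hmx)
    by_cases hx : x ∈ K'
    · exact h.derives_or_conflict hx hf
    · exact .inr (h.conflict fun m hm => hf m hm fun e => hx (e ▸ hm))
  rcases key h₀ hK₀ with h₀ | h₀
  · rcases key h₁ hK₁ with h₁ | h₁
    · exact .inr ⟨l, h₀, h₁⟩
    · exact h₁
  · exact h₀

/-! ### Trails -/

/-- A trail on which BCP has been completed without a conflict. -/
def Trail.Saturated (τ : Trail n) (D : CNF n) : Prop :=
  ¬ τ.InConflict D ∧ ∀ R ∈ D, ∀ m, ¬ τ.IsUnit R m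

theorem Trail.isTrue_cons {τ : Trail n} {l m : Lit n} {r : Option (Clause n)} :
    Trail.IsTrue ((l, r) :: τ) m ↔ m = l ∨ τ.IsTrue m := by
  simp only [Trail.IsTrue, List.mem_cons, Prod.mk.injEq]
  constructor
  · rintro ⟨r', ⟨h, -⟩ | h⟩
    · exact .inl h
    · exact .inr ⟨r', h⟩
  · rintro (h | ⟨r', h⟩)
    · exact ⟨r, .inl ⟨h, rfl⟩⟩
    · exact ⟨r', .inr h⟩

theorem Reachable.consistent {D : CNF n} {τ : Trail n} (h : Reachable D τ) (l : Lit n) :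
    ¬ (τ.IsTrue l ∧ τ.IsTrue (Lit.neg l)) := by
  have step : ∀ (τ : Trail n) (m : Lit n) (r : Option (Clause n)), τ.Unassigned m →
      (∀ l, ¬ (τ.IsTrue l ∧ τ.IsTrue (Lit.neg l))) →
      ∀ l, ¬ (Trail.IsTrue ((m, r) :: τ) l ∧ Trail.IsTrue ((m, r) :: τ) (Lit.neg l)) := by
    rintro τ m r hm ih l ⟨h₁, h₂⟩
    rw [Trail.isTrue_cons] at h₁ h₂
    rcases h₁ with rfl | h₁ <;> rcases h₂ with h₂ | h₂
    · exact Lit.neg_ne l h₂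
    · exact hm.2 h₂
    · subst h₂
      exact hm.2 (by simpa [Trail.IsFalse] using h₁)
    · exact ih l ⟨h₁, h₂⟩
  induction h generalizing l with
  | restart => simp [Trail.IsTrue]
  | propagate τ R m _ _ _ hu ih => exact step τ m _ hu.2.1 ih l
  | decide τ m _ _ _ hu ih => exact step τ m _ hu ih l

/-- Whatever the solver sets to true is forced by the decisions. -/
theorem Reachable.unitDerives {D : CNF n} {τ : Trail n} (h : Reachable D τ) {α : Set (Lit n)}
    (hα : ∀ l, τ.IsDecision l → l ∈ α) {l : Lit n} (hl : τ.IsTrue l) : UnitDerives D α l := by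
  induction h generalizing l with
  | restart => simp [Trail.IsTrue] at hl
  | propagate τ R m _ _ hR hu ih =>
    have ih' := @ih fun l hl => hα l (List.mem_cons_of_mem _ hl)
    rcases Trail.isTrue_cons.1 hl with rfl | hl
    · exact .unit R l hR hu.1 fun m' hm' hne => ih' (hu.2.2 m' hm' hne)
    · exact ih' hl
  | decide τ m _ _ _ _ ih =>
    rcases Trail.isTrue_cons.1 hl with rfl | hl
    · exact .assumption l (hα l List.mem_cons_self)
    · exact ih (fun l hl => hα l (List.mem_cons_of_mem _ hl)) hl

theorem Reachable.unitConflict {D : CNF n} {τ : Trail n} (h : Reachable D τ) {α : Set (Lit n)}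
    (hα : ∀ l, τ.IsDecision l → l ∈ α) (hc : τ.InConflict D) : UnitConflict D α := by
  obtain ⟨R, hR, hf⟩ := hc
  exact .inl ⟨R, hR, fun m hm => h.unitDerives hα (hf m hm)⟩

theorem Trail.Saturated.isTrue_of_unitDerives {D : CNF n} {τ : Trail n} (h : τ.Saturated D)
    {α : Set (Lit n)} (hα : ∀ l ∈ α, τ.IsTrue l) {l : Lit n} (hl : UnitDerives D α l) :
    τ.IsTrue l := by
  induction hl with
  | assumption l hl => exact hα l hl
  | unit R l hR hl _ ih =>
    by_contra hn
    by_cases hf : τ.IsFalse l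
    · exact h.1 ⟨R, hR, fun m hm => if e : m = l then e ▸ hf else ih m hm e⟩
    · exact h.2 R hR l ⟨hl, ⟨hn, hf⟩, ih⟩

theorem Trail.Saturated.not_unitConflict {D : CNF n} {τ : Trail n} (h : τ.Saturated D)
    (hr : Reachable D τ) {α : Set (Lit n)} (hα : ∀ l ∈ α, τ.IsTrue l) : ¬ UnitConflict D α := by
  rintro (⟨R, hR, hf⟩ | ⟨l, h₁, h₂⟩)
  · exact h.1 ⟨R, hR, fun m hm => h.isTrue_of_unitDerives hα (hf m hm)⟩
  · exact hr.consistent l ⟨h.isTrue_of_unitDerives hα h₁, h.isTrue_of_unitDerives hα h₂⟩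

/-- BCP terminates: from every reachable trail the solver gets, without further decisions, to a
conflict or to a saturated trail. -/
theorem Reachable.exists_propagation {D : CNF n} {τ : Trail n} (h : Reachable D τ) :
    ∃ τ' : Trail n, Reachable D τ' ∧ (τ'.InConflict D ∨ τ'.Saturated D) ∧
      (∀ l, τ.IsTrue l → τ'.IsTrue l) ∧ ∀ l, τ'.IsDecision l ↔ τ.IsDecision l := by
  classical
  induction hN : (Finset.univ.filter fun l : Lit n => ¬ τ.IsTrue l).card
    using Nat.strong_induction_on generalizing τ with
  | _ N ih =>
    by_cases hc : τ.InConflict D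
    · exact ⟨τ, h, .inl hc, fun _ => id, fun _ => Iff.rfl⟩
    by_cases hs : ∀ R ∈ D, ∀ m, ¬ τ.IsUnit R m
    · exact ⟨τ, h, .inr ⟨hc, hs⟩, fun _ => id, fun _ => Iff.rfl⟩
    push Not at hs
    obtain ⟨R, hR, l, hu⟩ := hs
    have hlt : (Finset.univ.filter fun m : Lit n => ¬ Trail.IsTrue ((l, some R) :: τ) m).card
        < N := by
      rw [← hN]
      refine Finset.card_lt_card ((Finset.ssubset_iff_of_subset fun m hm => ?_).2 ⟨l, ?_, ?_⟩)
      · simp only [Finset.mem_filter, Finset.mem_univ, true_and, Trail.isTrue_cons] at hm ⊢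
        exact fun h' => hm (.inr h')
      · simpa using hu.2.1.1
      · simp [Trail.isTrue_cons]
    obtain ⟨τ', h₁, h₂, h₃, h₄⟩ := ih _ hlt (.propagate τ R l h hc hR hu) rfl
    refine ⟨τ', h₁, h₂, fun m hm => h₃ m (Trail.isTrue_cons.2 (.inr hm)), fun m => ?_⟩
    rw [h₄]
    simp [Trail.IsDecision]

/-- The solver can set all literals of `α` to true, deciding only literals of `α`, unless unit
propagation from `α` reaches a contradiction. -/
theorem exists_saturated_trail {D : CNF n} (α : Finset (Lit n))
    (h : ¬ UnitConflict D (α : Set (Lit n))) :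
    ∃ τ : Trail n, Reachable D τ ∧ τ.Saturated D ∧ (∀ l ∈ α, τ.IsTrue l) ∧
      ∀ l, τ.IsDecision l → l ∈ α := by
  induction α using Finset.induction_on with
  | empty =>
    obtain ⟨τ, hr, hs, -, hd⟩ := (Reachable.restart (D := D)).exists_propagation
    have hd' : ∀ l, τ.IsDecision l → l ∈ (∅ : Finset (Lit n)) := fun l hl => by
      have := (hd l).1 hl
      simp [Trail.IsDecision] at this
    exact ⟨τ, hr, hs.resolve_left fun hc => h (hr.unitConflict hd' hc), by simp, hd'⟩
  | insert l α _ ih =>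
    have hsub : (α : Set (Lit n)) ⊆ (insert l α : Finset (Lit n)) := by simp
    obtain ⟨τ, hr, hs, ht, hd⟩ := ih fun hc => h (hc.mono subset_rfl hsub)
    by_cases hl : τ.IsTrue l
    · exact ⟨τ, hr, hs, fun m hm => (Finset.mem_insert.1 hm).elim (· ▸ hl) (ht m),
        fun m hm => Finset.mem_insert_of_mem (hd m hm)⟩
    have hf : ¬ τ.IsFalse l := fun hf =>
      h (.inr ⟨l, .assumption l (by simp), (hr.unitDerives hd hf).mono subset_rfl hsub⟩)
    obtain ⟨τ', hr', hs', ht', hd'⟩ := (hr.decide τ l hs.1 hs.2 ⟨hl, hf⟩).exists_propagation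
    have hd'' : ∀ m, τ'.IsDecision m → m ∈ insert l α := fun m hm => by
      rcases List.mem_cons.1 ((hd' m).1 hm) with e | hm
      · exact Finset.mem_insert.2 (.inl (congrArg Prod.fst e))
      · exact Finset.mem_insert_of_mem (hd m hm)
    refine ⟨τ', hr', hs'.resolve_left fun hc => h (hr'.unitConflict hd'' hc), fun m hm => ?_, hd''⟩
    refine ht' m (Trail.isTrue_cons.2 ?_)
    exact (Finset.mem_insert.1 hm).imp id (ht m)

theorem finalConflict_of_unitConflict {D : CNF n} (h : UnitConflict D ∅) : FinalConflict D := by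
  obtain ⟨τ, hr, hs, -, hd⟩ := (Reachable.restart (D := D)).exists_propagation
  refine ⟨τ, hr, hs.resolve_right fun hs => hs.not_unitConflict hr (by simp) h, fun l hl => ?_⟩
  have := (hd l).1 hl
  simp [Trail.IsDecision] at this

/-- If unit propagation refutes the negation of a clause that is not absorbed, then one conflict
suffices to learn a subclause of it. -/
theorem exists_conflictStep {D : CNF n} {K : Clause n} (h : UnitConflict D (negation K))
    (hK : ¬ Absorbs D K) : ∃ L ⊆ K, ConflictStep D (insert L D) := by
  classical
  simp only [Absorbs, not_forall, not_or] at hK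
  obtain ⟨l, hl, hnd, hnc⟩ := hK
  let α : Finset (Lit n) := Finset.univ.filter fun m => Lit.neg m ∈ K ∧ Lit.neg m ≠ l
  have hα : (α : Set (Lit n)) = {m | Lit.neg m ∈ K ∧ Lit.neg m ≠ l} := by simp [α]
  rw [← hα] at hnd hnc
  have hmem : ∀ m ∈ negation K, m ∈ α ∨ m = Lit.neg l := fun m hm => by
    by_cases e : Lit.neg m = l
    · exact .inr (by simp [← e])
    · exact .inl (by simpa [α] using ⟨hm, e⟩)
  obtain ⟨τ, hr, hs, ht, hd⟩ := exists_saturated_trail α hnc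
  -- If `¬ l` were already true, all literals of `K` would be false without any conflict.
  have hun : τ.Unassigned (Lit.neg l) := by
    refine ⟨fun hn => ?_, fun hn => hnd (hr.unitDerives hd (by simpa [Trail.IsFalse] using hn))⟩
    exact hs.not_unitConflict hr (fun m hm => (hmem m hm).elim (ht m) (· ▸ hn)) h
  obtain ⟨τ', hr', hs', ht', hd'⟩ := (hr.decide τ _ hs.1 hs.2 hun).exists_propagation
  obtain ⟨R, hR, hf⟩ : τ'.InConflict D := by
    refine hs'.resolve_right fun hs' => hs'.not_unitConflict hr' (fun m hm => ?_) h
    exact ht' m (Trail.isTrue_cons.2 ((hmem m hm).symm.imp id (ht m)))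
  let L : Clause n := Finset.univ.filter fun m =>
    τ'.IsDecision (Lit.neg m) ∧ Ancestor τ' R (Lit.neg m)
  refine ⟨L, fun m hm => ?_, τ', R, L, hr', hR, hf, ⟨Lit.neg l, (hd' _).2 List.mem_cons_self⟩,
    fun m => by simp [L], rfl⟩
  rcases List.mem_cons.1 ((hd' _).1 (Finset.mem_filter.1 hm).2.1) with e | hm
  · have : m = l := by simpa using congrArg Lit.neg (congrArg Prod.fst e)
    exact this ▸ hl
  · simpa using (Finset.mem_filter.1 (hd _ hm)).2.1

/-! ### Runs -/

/-- The databases `db 0, …, db T` arise from `F` by `T` conflicts. -/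
structure IsRun (F : CNF n) (T : ℕ) (db : ℕ → CNF n) : Prop where
  start : db 0 = F
  step : ∀ t < T, ConflictStep (db t) (db (t + 1))

/-- Every run with `T` conflicts that satisfies `P` at its end can be continued, by at most `N`
further conflicts, to a run that satisfies `Q` at its end. -/
def Attainable (F : CNF n) (P : CNF n → Prop) (N : ℕ) (Q : CNF n → Prop) : Prop :=
  ∀ T db, IsRun F T db → P (db T) → ∃ T' db', IsRun F T' db' ∧ T ≤ T' ∧ T' ≤ T + N ∧
    (∀ t ≤ T, db' t = db t) ∧ db T ⊆ db' T' ∧ Q (db' T')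

theorem Attainable.of_imp {F : CNF n} {P Q : CNF n → Prop} (h : ∀ D, P D → Q D) (N : ℕ) :
    Attainable F P N Q := fun T db hrun hP =>
  ⟨T, db, hrun, le_rfl, Nat.le_add_right _ _, fun _ _ => rfl, subset_rfl, h _ hP⟩

theorem Attainable.trans {F : CNF n} {P Q R : CNF n → Prop} {M N : ℕ}
    (h₁ : Attainable F P M Q) (h₂ : Attainable F Q N R) : Attainable F P (M + N) R := by
  intro T db hrun hP
  obtain ⟨T₁, db₁, r₁, a₁, b₁, e₁, s₁, hQ⟩ := h₁ T db hrun hP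
  obtain ⟨T₂, db₂, r₂, a₂, b₂, e₂, s₂, hR⟩ := h₂ T₁ db₁ r₁ hQ
  exact ⟨T₂, db₂, r₂, a₁.trans a₂, by omega, fun t ht => (e₂ t (ht.trans a₁)).trans (e₁ t ht),
    s₁.trans s₂, hR⟩

theorem Attainable.mono {P P' Q : CNF n → Prop} {N N' : ℕ} (h : Attainable F P N Q)
    (hP : ∀ D, P' D → P D) (hN : N ≤ N') : Attainable F P' N' Q := by
  intro T db hrun hp
  obtain ⟨T', db', r, a, b, q⟩ := h T db hrun (hP _ hp)
  exact ⟨T', db', r, a, by omega, q⟩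

/-- Properties that survive learning can be carried along. -/
theorem Attainable.and_left {F : CNF n} {P Q : CNF n → Prop} {N : ℕ} (h : Attainable F P N Q)
    (hP : ∀ D D', D ⊆ D' → P D → P D') : Attainable F P N fun D => P D ∧ Q D := by
  intro T db hrun hp
  obtain ⟨T', db', r, a, b, e, s, hQ⟩ := h T db hrun hp
  exact ⟨T', db', r, a, b, e, s, hP _ _ s hp, hQ⟩

/-- Finitely many clauses, each of which is attainable from `P`, are attainable together. -/
theorem Attainable.forall_mem {F : CNF n} {P : CNF n → Prop} {N : ℕ}
    (hP : ∀ D D', D ⊆ D' → P D → P D') (𝒦 : Finset (Clause n))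
    (h : ∀ K ∈ 𝒦, Attainable F P N (Simulates · K)) :
    Attainable F P (𝒦.card * N) fun D => ∀ K ∈ 𝒦, Simulates D K := by
  induction 𝒦 using Finset.induction_on with
  | empty => exact .of_imp (by simp) _
  | insert K 𝒦 hK ih =>
    rw [Finset.card_insert_of_notMem hK, add_one_mul]
    have h₁ := (ih fun K' hK' => h K' (Finset.mem_insert_of_mem hK')).and_left hP
    intro T db hrun hp
    obtain ⟨T₁, db₁, r₁, a₁, b₁, e₁, s₁, hp₁, q₁⟩ := h₁ T db hrun hp
    obtain ⟨T₂, db₂, r₂, a₂, b₂, e₂, s₂, q₂⟩ := h K (Finset.mem_insert_self _ _) T₁ db₁ r₁ hp₁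
    refine ⟨T₂, db₂, r₂, a₁.trans a₂, by omega,
      fun t ht => (e₂ t (ht.trans a₁)).trans (e₁ t ht), s₁.trans s₂, fun K' hK' => ?_⟩
    rcases Finset.mem_insert.1 hK' with rfl | hK'
    · exact q₂
    · exact (q₁ K' hK').mono s₂

theorem attainable_of_unitConflict {F : CNF n} {P : CNF n → Prop} {K : Clause n}
    (h : ∀ D, P D → UnitConflict D (negation K)) : Attainable F P 1 (Simulates · K) := by
  intro T db hrun hP
  by_cases hK : Absorbs (db T) K
  · refine ⟨T, db, hrun, le_rfl, Nat.le_add_right _ _, fun _ _ => rfl, subset_rfl, hK, ?_⟩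
    rintro rfl
    exact (h _ hP).mono subset_rfl (by simp [negation])
  obtain ⟨L, hL, hstep⟩ := exists_conflictStep (h _ hP) hK
  refine ⟨T + 1, Function.update db (T + 1) (insert L (db T)), ⟨?_, fun t ht => ?_⟩,
    Nat.le_succ T, le_rfl, fun t ht => ?_, ?_, ?_⟩
  · simpa using hrun.start
  · rw [Function.update_of_ne (by omega)]
    rcases Nat.lt_succ_iff_lt_or_eq.1 ht with ht | rfl
    · rw [Function.update_of_ne (by omega)]
      exact hrun.step t ht
    · rwa [Function.update_self]
  · exact Function.update_of_ne (by omega) _ _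
  · simp
  · simpa using (Simulates.of_mem (Finset.mem_insert_self L (db T))).weaken hL

/-! ### Residual clauses -/

/-- The part of `R` on the variables in `P` is falsified by `σ`. -/
def FalseOn (P : Finset (Fin n)) (σ : Fin n → Bool) (R : Clause n) : Prop :=
  ∀ l ∈ R, l.1 ∈ P → σ l.1 ≠ l.2

instance (P : Finset (Fin n)) (σ : Fin n → Bool) : DecidablePred (FalseOn P σ) := fun R =>
  inferInstanceAs (Decidable (∀ l ∈ R, l.1 ∈ P → σ l.1 ≠ l.2))

/-- The union of the `P`-parts of those clauses of `G` whose `P`-part is falsified by `σ`. -/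
def residual (P : Finset (Fin n)) (G : CNF n) (σ : Fin n → Bool) : Clause n :=
  (G.filter (FalseOn P σ)).biUnion fun R => R.filter (·.1 ∈ P)

/-- No clause of `G` all of whose variables are in `P` is falsified by `σ`. -/
def Undecided (P : Finset (Fin n)) (G : CNF n) (σ : Fin n → Bool) : Prop :=
  ∀ R ∈ G, FalseOn P σ R → ∃ z ∈ R, z.1 ∉ P

theorem mem_residual {P : Finset (Fin n)} {G : CNF n} {σ : Fin n → Bool} {l : Lit n} :
    l ∈ residual P G σ ↔ ∃ R ∈ G, FalseOn P σ R ∧ l ∈ R ∧ l.1 ∈ P := by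
  simp only [residual, Finset.mem_biUnion, Finset.mem_filter, and_assoc]

theorem residual_empty (G : CNF n) (σ : Fin n → Bool) : residual ∅ G σ = ∅ := by
  ext l
  simp [mem_residual]

theorem residual_union (P : Finset (Fin n)) (G H : CNF n) (σ : Fin n → Bool) :
    residual P (G ∪ H) σ = residual P G σ ∪ residual P H σ := by
  simp only [residual, Finset.filter_union, Finset.union_biUnion]

theorem subset_residual {P : Finset (Fin n)} {G : CNF n} {σ : Fin n → Bool} {R : Clause n}
    (hR : R ∈ G) (hf : FalseOn P σ R) (hP : ∀ l ∈ R, l.1 ∈ P) : R ⊆ residual P G σ :=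
  fun l hl => mem_residual.2 ⟨R, hR, hf, hl, hP l hl⟩

/-- Querying the variable `x` adds at most one literal to the residual clause. -/
theorem residual_insert_update_subset (P : Finset (Fin n)) (G : CNF n) (σ : Fin n → Bool)
    {x : Fin n} (hx : x ∉ P) (b : Bool) :
    residual (insert x P) G (Function.update σ x b) ⊆ insert (x, !b) (residual P G σ) := by
  intro l hl
  obtain ⟨R, hR, hf, hlR, hlP⟩ := mem_residual.1 hl
  rcases Finset.mem_insert.1 hlP with hlx | hlP
  · have := hf l hlR (Finset.mem_insert.2 (.inl hlx))
    rw [hlx, Function.update_self] at this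
    refine Finset.mem_insert.2 (.inl (Prod.ext hlx ?_))
    cases b <;> simpa using this.symm
  · refine Finset.mem_insert_of_mem (mem_residual.2 ⟨R, hR, fun m hm hmP => ?_, hlR, hlP⟩)
    have := hf m hm (Finset.mem_insert_of_mem hmP)
    rwa [Function.update_of_ne fun e : m.1 = x => hx (e ▸ hmP)] at this

/-- The residual clause for `P` follows by resolving on `x` from those for `insert x P`. The
clause `C` in the background remains falsified: if `x` occurs in `C`, one branch is enough. -/
theorem unitConflict_of_residual {D G : CNF n} {C : Clause n} {P : Finset (Fin n)} {x : Fin n}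
    (hx : x ∉ P)
    (h : ∀ σ, ¬ SatClause σ C → Simulates D (C ∪ residual (insert x P) G σ))
    {σ : Fin n → Bool} (hσ : ¬ SatClause σ C) :
    UnitConflict D (negation (C ∪ residual P G σ)) := by
  have hsub : ∀ b, C ∪ residual (insert x P) G (Function.update σ x b) ⊆
      insert (x, !b) (C ∪ residual P G σ) := fun b => by
    refine Finset.union_subset (fun l hl => by simp [hl]) ?_
    refine (residual_insert_update_subset P G σ hx b).trans (Finset.insert_subset_insert _ ?_)
    exact Finset.subset_union_right
  by_cases hxC : ∃ c, (x, c) ∈ C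
  · obtain ⟨c, hc⟩ := hxC
    have hσx : σ x = !c := by
      have : σ x ≠ c := fun e => hσ ⟨(x, c), hc, e⟩
      revert this
      cases σ x <;> cases c <;> simp
    have hs := hsub (!c)
    rw [← hσx, Function.update_eq_self, hσx, Bool.not_not,
      Finset.insert_eq_of_mem (Finset.mem_union_left _ hc)] at hs
    refine ((h σ hσ).weaken hs).conflict fun m hm => .assumption _ ?_
    simpa [negation] using hm
  · have hup : ∀ b, ¬ SatClause (Function.update σ x b) C := by
      rintro b ⟨l, hl, hlσ⟩
      refine hσ ⟨l, hl, ?_⟩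
      rwa [Function.update_of_ne fun e : l.1 = x => hxC ⟨l.2, by rwa [← e]⟩] at hlσ
    exact unitConflict_of_resolvent (l := (x, true)) (h _ (hup false)) (h _ (hup true))
      (hsub false) (hsub true)

/-! ### Pathwidth bounds the number of residual clauses -/

/-- The first `i` variables in the order `e`. -/
def processed (e : Equiv.Perm (Fin n)) (i : ℕ) : Finset (Fin n) :=
  Finset.univ.filter fun x => (e.symm x : ℕ) < i

/-- At every point of the variable order `e`, the residual clause of `A` for an undecided
assignment `σ` is determined by a subset of a set of size `w + 1`. -/
def NarrowOrder (e : Equiv.Perm (Fin n)) (A : CNF n) (w : ℕ) : Prop :=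
  ∀ i < n, ∃ (V : Type) (B : Finset V) (st : (Fin n → Bool) → Finset V),
    B.card ≤ w + 1 ∧ (∀ σ, st σ ⊆ B) ∧
    ∀ σ σ', Undecided (processed e i) A σ → st σ = st σ' →
      residual (processed e i) A σ ⊆ residual (processed e i) A σ'

theorem processed_zero (e : Equiv.Perm (Fin n)) : processed e 0 = ∅ := by
  simp [processed]

theorem mem_processed_self (e : Equiv.Perm (Fin n)) (x : Fin n) : x ∈ processed e n := by
  simp [processed]

theorem processed_succ (e : Equiv.Perm (Fin n)) (i : Fin n) :
    processed e (i + 1) = insert (e i) (processed e i) := by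
  ext x
  simp only [processed, Finset.mem_filter, Finset.mem_univ, true_and, Finset.mem_insert,
    Nat.lt_succ_iff_lt_or_eq]
  rw [or_comm, ← Equiv.symm_apply_eq, Fin.ext_iff]

theorem notMem_processed (e : Equiv.Perm (Fin n)) (i : Fin n) : e i ∉ processed e i := by
  simp [processed]

/-- If the variables are sorted by the first bag containing them, then at each point there is a bag
`b` such that processed variables first occur up to `b` and the others first occur from `b` on. -/
theorem IsPathDecomposition.exists_order {V : Type} {G : SimpleGraph V} {m : ℕ}
    {B : Fin m → Finset V} (hB : IsPathDecomposition G B) (ι : Fin n → V) :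
    ∃ e : Equiv.Perm (Fin n), ∀ i < n, ∃ b : Fin m,
      (∀ y ∈ processed e i, ∃ j ≤ b, ι y ∈ B j) ∧
      ∀ z ∉ processed e i, ∀ j, ι z ∈ B j → b ≤ j := by
  classical
  have hf : ∀ x, ∃ j, ι x ∈ B j ∧ ∀ j', ι x ∈ B j' → j ≤ j' := fun x => by
    obtain ⟨j, hj⟩ := hB.covers (ι x)
    have hne : (Finset.univ.filter fun j => ι x ∈ B j).Nonempty := ⟨j, by simpa using hj⟩
    refine ⟨_, (Finset.mem_filter.1 (Finset.min'_mem _ hne)).2, fun j' hj' => ?_⟩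
    exact Finset.min'_le _ _ (by simpa using hj')
  choose f hf₁ hf₂ using hf
  have hmono := Tuple.monotone_sort f
  refine ⟨Tuple.sort f, fun i hi => ⟨f (Tuple.sort f ⟨i, hi⟩), fun y hy => ?_, fun z hz j hj => ?_⟩⟩
  · refine ⟨f y, ?_, hf₁ y⟩
    have h := hmono (a := (Tuple.sort f).symm y) (b := ⟨i, hi⟩)
      (Fin.le_def.2 (Finset.mem_filter.1 hy).2.le)
    simpa using h
  · refine le_trans ?_ (hf₂ z j hj)
    have h := hmono (a := ⟨i, hi⟩) (b := (Tuple.sort f).symm z)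
      (Fin.le_def.2 (by simpa [processed] using hz))
    simpa using h

theorem CNF.PathwidthAtMost.exists_narrowOrder {A : CNF n} {w : ℕ} (h : A.PathwidthAtMost w) :
    ∃ e, NarrowOrder e A w := by
  classical
  rcases h with ⟨m, B, hB, hw⟩ | ⟨m, B, hB, hw⟩
  · -- All processed variables of a clause that is not fully processed are in the current bag.
    obtain ⟨e, he⟩ := hB.exists_order id
    refine ⟨e, fun i hi => ?_⟩
    obtain ⟨b, hb₁, hb₂⟩ := he i hi
    refine ⟨Fin n, B b, fun σ => (B b).filter fun x => σ x = true, hw b,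
      fun σ => Finset.filter_subset _ _, fun σ σ' hu hst l hl => ?_⟩
    obtain ⟨R, hR, hf, hlR, hlP⟩ := mem_residual.1 hl
    obtain ⟨z, hzR, hz⟩ := hu R hR hf
    refine mem_residual.2 ⟨R, hR, fun y hy hyP => ?_, hlR, hlP⟩
    obtain ⟨j, hj, hyj⟩ := hb₁ y.1 hyP
    obtain ⟨j', hyj', hzj'⟩ := hB.edges y.1 z.1 <| (SimpleGraph.fromRel_adj _ _ _).2
      ⟨fun e => hz (e ▸ hyP), .inl ⟨R, hR, Finset.mem_image_of_mem _ hy,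
        Finset.mem_image_of_mem _ hzR⟩⟩
    have hyb : y.1 ∈ B b := hB.contiguous y.1 j b j' hj (hb₂ z.1 hz j' hzj') hyj hyj'
    have := Finset.ext_iff.1 hst y.1
    simp only [Finset.mem_filter, hyb, true_and] at this
    rw [← Bool.eq_iff_iff.2 this]
    exact hf y hy hyP
  · -- A clause that is not in the current bag `b` and has an unprocessed variable occurs in later
    -- bags only, so its processed variables, which occur in bags up to `b`, are in bag `b`.
    obtain ⟨e, he⟩ := hB.exists_order Sum.inl
    refine ⟨e, fun i hi => ?_⟩
    obtain ⟨b, hb₁, hb₂⟩ := he i hi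
    refine ⟨_, B b, fun σ => (B b).filter fun v =>
      Sum.elim (fun x => σ x = true) (fun R => FalseOn (processed e i) σ R.1) v, hw b,
      fun σ => Finset.filter_subset _ _, fun σ σ' hu hst l hl => ?_⟩
    obtain ⟨R, hR, hf, hlR, hlP⟩ := mem_residual.1 hl
    obtain ⟨z, hzR, hz⟩ := hu R hR hf
    refine mem_residual.2 ⟨R, hR, ?_, hlR, hlP⟩
    have hadj : ∀ y ∈ R, ∃ j, Sum.inl y.1 ∈ B j ∧ Sum.inr ⟨R, hR⟩ ∈ B j := fun y hy =>
      hB.edges _ _ <| (SimpleGraph.fromRel_adj _ _ _).2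
        ⟨Sum.inl_ne_inr, .inl ⟨y.1, ⟨R, hR⟩, rfl, rfl, Finset.mem_image_of_mem _ hy⟩⟩
    by_cases hRb : Sum.inr ⟨R, hR⟩ ∈ B b
    · have := Finset.ext_iff.1 hst (Sum.inr ⟨R, hR⟩)
      simp only [Finset.mem_filter, hRb, true_and, Sum.elim_inr] at this
      exact this.1 hf
    · intro y hy hyP
      obtain ⟨j, hj, hyj⟩ := hb₁ y.1 hyP
      obtain ⟨j₁, hyj₁, hRj₁⟩ := hadj y hy
      obtain ⟨j₂, hzj₂, hRj₂⟩ := hadj z hzR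
      have hbj₁ : b ≤ j₁ := le_of_not_ge fun hle =>
        hRb (hB.contiguous _ j₁ b j₂ hle (hb₂ z.1 hz j₂ hzj₂) hRj₁ hRj₂)
      have hyb : Sum.inl y.1 ∈ B b := hB.contiguous _ j b j₁ hj hbj₁ hyj hyj₁
      have := Finset.ext_iff.1 hst (Sum.inl y.1)
      simp only [Finset.mem_filter, hyb, true_and, Sum.elim_inl] at this
      rw [← Bool.eq_iff_iff.2 this]
      exact hf y hy hyP

theorem card_image_le_of_determines {α β γ : Type*} [DecidableEq β] [DecidableEq γ]
    (s : Finset α) (f : α → β) (g : α → γ)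
    (h : ∀ x ∈ s, ∀ y ∈ s, g x = g y → f x = f y) : (s.image f).card ≤ (s.image g).card := by
  rcases isEmpty_or_nonempty α with _ | _
  · simp [Finset.eq_empty_of_isEmpty s]
  choose! r hr using fun (c : γ) (hc : c ∈ s.image g) => Finset.mem_image.1 hc
  refine (Finset.card_le_card fun b hb => ?_).trans
    (Finset.card_image_le (s := s.image g) (f := f ∘ r))
  obtain ⟨x, hx, rfl⟩ := Finset.mem_image.1 hb
  have hgx := Finset.mem_image_of_mem g hx
  exact Finset.mem_image.2 ⟨g x, hgx, h _ (hr _ hgx).1 _ hx (hr _ hgx).2⟩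

/-- Besides the state in `A`, a residual clause of `A ∪ S` depends on which clauses of `S` are
falsified so far. -/
theorem card_image_residual_le {e : Equiv.Perm (Fin n)} {A S : CNF n} {w : ℕ}
    (h : NarrowOrder e A w) (C : Clause n) {i : ℕ} (hi : i < n)
    (𝒮 : Finset (Fin n → Bool)) (h𝒮 : ∀ σ ∈ 𝒮, Undecided (processed e i) A σ) :
    (𝒮.image fun σ => C ∪ residual (processed e i) (A ∪ S) σ).card ≤ 2 ^ (w + 1 + S.card) := by
  classical
  obtain ⟨V, B, st, hB, hst, hdet⟩ := h i hi
  refine (card_image_le_of_determines 𝒮 _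
    (fun σ => (st σ, S.filter (FalseOn (processed e i) σ))) fun σ hσ σ' hσ' hg => ?_).trans ?_
  · obtain ⟨h₁, h₂⟩ := Prod.mk.injEq .. ▸ hg
    have hA := (hdet σ σ' (h𝒮 σ hσ) h₁).antisymm (hdet σ' σ (h𝒮 σ' hσ') h₁.symm)
    have hS : residual (processed e i) S σ = residual (processed e i) S σ' := by
      unfold residual
      rw [h₂]
    simp only [residual_union, hA, hS]
  · calc _ ≤ (B.powerset ×ˢ S.powerset).card := Finset.card_le_card fun q hq => by
          obtain ⟨σ, -, rfl⟩ := Finset.mem_image.1 hq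
          simp [hst σ, Finset.filter_subset]
      _ = 2 ^ (B.card + S.card) := by
          rw [Finset.card_product, Finset.card_powerset, Finset.card_powerset, pow_add]
      _ ≤ 2 ^ (w + 1 + S.card) := Nat.pow_le_pow_right two_pos (by omega)

/-! ### Deriving a clause from a chunk -/

theorem simulates_mono_forall {G D D' : CNF n} (hD : D ⊆ D') (h : ∀ R ∈ G, Simulates D R) :
    ∀ R ∈ G, Simulates D' R := fun R hR => (h R hR).mono hD

/-- A clause that follows from a chunk of pathwidth `w` and a few simulated clauses costs at most
`n * 2 ^ (w + 1 + |S|)` conflicts. -/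
theorem attainable_of_entails {F A S : CNF n} {w : ℕ} {C : Clause n} (hA : A.PathwidthAtMost w)
    (hC : Entails (A ∪ S) {C}) :
    Attainable F (fun D => ∀ R ∈ A ∪ S, Simulates D R) (n * 2 ^ (w + 1 + S.card))
      (Simulates · C) := by
  classical
  obtain ⟨e, he⟩ := hA.exists_narrowOrder
  set N := 2 ^ (w + 1 + S.card)
  let P : CNF n → Prop := fun D => ∀ R ∈ A ∪ S, Simulates D R
  let Q : ℕ → CNF n → Prop := fun i D => P D ∧ ∀ σ, ¬ SatClause σ C →
    Simulates D (C ∪ residual (processed e i) (A ∪ S) σ)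
  have hPmono : ∀ D D', D ⊆ D' → P D → P D' := fun _ _ => simulates_mono_forall
  have hQmono : ∀ i D D', D ⊆ D' → Q i D → Q i D' := fun i D D' hD h =>
    ⟨hPmono D D' hD h.1, fun σ hσ => (h.2 σ hσ).mono hD⟩
  have hstage : ∀ i < n, Attainable F (Q (i + 1)) N (Q i) := by
    intro i hi
    let 𝒦 := (Finset.univ.filter fun σ => ¬ SatClause σ C ∧ Undecided (processed e i) A σ).image
      fun σ => C ∪ residual (processed e i) (A ∪ S) σ
    have hcard : 𝒦.card ≤ N := card_image_residual_le he C hi _ fun σ hσ =>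
      (Finset.mem_filter.1 hσ).2.2
    have h𝒦 : Attainable F (Q (i + 1)) (𝒦.card * 1) fun D => ∀ K ∈ 𝒦, Simulates D K := by
      refine .forall_mem (hQmono (i + 1)) 𝒦 fun K hK => attainable_of_unitConflict fun D hD => ?_
      obtain ⟨σ, hσ, rfl⟩ := Finset.mem_image.1 hK
      have hq := hD.2
      rw [show i + 1 = ((⟨i, hi⟩ : Fin n) : ℕ) + 1 from rfl, processed_succ] at hq
      exact unitConflict_of_residual (notMem_processed e ⟨i, hi⟩) hq (Finset.mem_filter.1 hσ).2.1
    have hend : ∀ D, (Q (i + 1) D ∧ ∀ K ∈ 𝒦, Simulates D K) → Q i D := by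
      refine fun D hD => ⟨hD.1.1, fun σ hσ => ?_⟩
      by_cases hu : Undecided (processed e i) A σ
      · exact hD.2 _ (Finset.mem_image_of_mem _ (by simpa using ⟨hσ, hu⟩))
      · simp only [Undecided] at hu
        push Not at hu
        obtain ⟨R, hR, hf, hRP⟩ := hu
        have hR' := Finset.mem_union_left S hR
        exact (hD.1.1 R hR').weaken
          ((subset_residual hR' hf hRP).trans Finset.subset_union_right)
    have := (h𝒦.and_left (hQmono (i + 1))).trans (Attainable.of_imp hend (N - 𝒦.card))
    rwa [mul_one, Nat.add_sub_cancel' hcard] at this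
  have hdown : ∀ i ≤ n, Attainable F (Q i) (i * N) (Q 0) := by
    intro i
    induction i with
    | zero => exact fun _ => .of_imp (fun _ => id) _
    | succ i ih =>
      intro hi
      rw [add_one_mul, add_comm (i * N)]
      exact (hstage i hi).trans (ih (by omega))
  have htop : Attainable F P 0 (Q n) := by
    refine .of_imp (fun D hD => ⟨hD, fun σ hσ => ?_⟩) 0
    obtain ⟨R, hR, hRσ⟩ : ∃ R ∈ A ∪ S, ¬ SatClause σ R := by
      by_contra! hsat
      exact hσ (hC σ hsat C (by simp))
    refine (hD R hR).weaken ((subset_residual hR ?_ ?_).trans Finset.subset_union_right)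
    · exact fun l hl _ hs => hRσ ⟨l, hl, hs⟩
    · exact fun l _ => mem_processed_self e l.1
  have hbot : Attainable F (Q 0) 0 (Simulates · C) := by
    refine .of_imp (fun D hD => ?_) 0
    by_cases hσ : ∃ σ, ¬ SatClause σ C
    · obtain ⟨σ, hσ⟩ := hσ
      simpa [processed_zero, residual_empty] using hD.2 σ hσ
    · -- A clause without falsifying assignment is a tautology, which every database absorbs.
      push Not at hσ
      obtain ⟨l, hl, hnl⟩ : ∃ l ∈ C, Lit.neg l ∈ C := by
        obtain ⟨l, hl, hlσ⟩ := hσ fun x => !decide ((x, true) ∈ C)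
        refine ⟨l, hl, ?_⟩
        obtain ⟨x, _ | _⟩ := l
        · simpa [Lit.neg] using hlσ
        · simp [hl] at hlσ
      refine ⟨fun m hm => ?_, fun h0 => by simp [h0] at hl⟩
      by_cases h₁ : l = m
      · subst h₁
        exact .inl (.assumption _ ⟨hnl, Lit.neg_ne l⟩)
      by_cases h₂ : Lit.neg l = m
      · subst h₂
        exact .inl (.assumption _ ⟨by simpa using hl, by simpa using h₁⟩)
      · exact .inr (.inr ⟨l, .assumption _ ⟨hnl, h₂⟩, .assumption _ (by simpa using ⟨hl, h₁⟩)⟩)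
  have := (htop.trans (hdown n le_rfl)).trans hbot
  rwa [zero_add, add_zero] at this

/-! ### Runs along a proofdoor -/

section Proofdoor

variable {F : CNF n} {k c w s : ℕ} {A I : ℕ → CNF n}

theorem IsProofdoor.chunk_subset (h : IsProofdoor F k A I c w s) {j : ℕ} (hj : 1 ≤ j)
    (hjk : j ≤ k) : A j ⊆ F := by
  rw [h.eq_conj]
  exact Finset.subset_biUnion_of_mem A (Finset.mem_Ioc.2 ⟨hj, hjk⟩)

/-- The databases in which the `j`-th interpolant is available. -/
def Holds (F : CNF n) (I : ℕ → CNF n) (j : ℕ) (D : CNF n) : Prop :=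
  F ⊆ D ∧ ∀ C ∈ I j, Simulates D C

theorem Holds.mono {j : ℕ} {D D' : CNF n} (hD : D ⊆ D') (h : Holds F I j D) : Holds F I j D' :=
  ⟨h.1.trans hD, simulates_mono_forall hD h.2⟩

theorem IsProofdoor.attainable_clause (h : IsProofdoor F k A I c w s) {j : ℕ}
    (hjk : j + 1 ≤ k) {S : CNF n} (hS : S ⊆ I j) (hs : S.card ≤ s) {C : Clause n}
    (hC : Entails (A (j + 1) ∪ S) {C}) :
    Attainable F (Holds F I j) (n * 2 ^ (w + 1 + s)) (Simulates · C) := by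
  refine (attainable_of_entails (h.pathwidth_le (j + 1) (by omega) hjk) hC).mono
    (fun D hD R hR => ?_) (Nat.mul_le_mul_left _ (Nat.pow_le_pow_right two_pos (by omega)))
  rcases Finset.mem_union.1 hR with hR | hR
  · exact .of_mem (hD.1 (h.chunk_subset (by omega) hjk hR))
  · exact hD.2 R (hS hR)

theorem IsProofdoor.attainable_interpolant (h : IsProofdoor F k A I c w s) {j : ℕ}
    (hjk : j + 1 < k) :
    Attainable F (Holds F I j) (c * (n * 2 ^ (w + 1 + s))) (Holds F I (j + 1)) := by
  have h₁ : Attainable F (Holds F I j) ((I (j + 1)).card * (n * 2 ^ (w + 1 + s)))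
      fun D => ∀ C ∈ I (j + 1), Simulates D C := by
    refine .forall_mem (fun _ _ => Holds.mono) _ fun C hC => ?_
    obtain ⟨S, hS, hs, hent⟩ := h.support (j + 1) (by omega) hjk C hC
    exact h.attainable_clause hjk.le hS hs hent
  refine (((h₁.and_left fun _ _ => Holds.mono).trans
    (.of_imp (fun D hD => ⟨hD.1.1, hD.2⟩) 0))).mono (fun _ => id) ?_
  exact Nat.mul_le_mul_right _ (h.card_le (j + 1) (by omega) hjk)

theorem IsProofdoor.attainable_empty (h : IsProofdoor F k A I c w s) :
    Attainable F (Holds F I (k - 1)) (n * 2 ^ (w + 1 + s)) (Simulates · ∅) := by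
  have hk := h.one_le
  have hkk : k - 1 + 1 = k := by omega
  refine h.attainable_clause hkk.le subset_rfl h.card_last_le ?_
  rw [hkk]
  intro σ hσ
  exfalso
  rcases hk.eq_or_lt with rfl | hk
  · refine h.unsat σ fun R hR => hσ R (Finset.mem_union_left _ ?_)
    have hF := h.eq_conj
    simp only [suffix] at hF
    simpa [hF] using hR
  · have hi := (h.interpolant (k - 1) (by omega) (by omega)).refutes σ
    refine hi fun R hR => hσ R ?_
    simp only [suffix, Finset.mem_union, Finset.mem_biUnion, Finset.mem_Ioc] at hR ⊢
    rcases hR with hR | ⟨i, hi, hR⟩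
    · exact .inr hR
    · obtain rfl : i = k := by omega
      exact .inl hR

theorem IsProofdoor.exists_run (h : IsProofdoor F k A I c w s) {M : ℕ}
    (hM : c * (n * 2 ^ (w + 1 + s)) ≤ M) {j : ℕ} (hjk : j < k) :
    ∃ T db, IsRun F T db ∧ T ≤ j * M ∧ Holds F I j (db T) ∧
      ∀ i, 1 ≤ i → i ≤ j → ∃ t ≤ T, t ≤ i * M ∧ ∀ C ∈ I i, Absorbs (db t) C := by
  induction j with
  | zero =>
    exact ⟨0, fun _ => F, ⟨rfl, by simp⟩, by simp, ⟨subset_rfl, by simp [h.init]⟩,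
      fun i hi hi' => by omega⟩
  | succ j ih =>
    obtain ⟨T, db, hrun, hT, hj, hI⟩ := ih (by omega)
    obtain ⟨T', db', hrun', hTT', hT', hdb, -, hj'⟩ :=
      (h.attainable_interpolant hjk).mono (fun _ => id) hM T db hrun hj
    have hle : T' ≤ (j + 1) * M := by
      rw [add_one_mul]
      omega
    refine ⟨T', db', hrun', hle, hj', fun i hi hij => ?_⟩
    rcases Nat.le_succ_iff.1 hij with hij | rfl
    · obtain ⟨t, ht, hti, hC⟩ := hI i hi hij
      exact ⟨t, ht.trans hTT', hti, by rwa [hdb t ht]⟩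
    · exact ⟨T', le_rfl, hle, fun C hC => (hj'.2 C hC).1⟩

end Proofdoor

/-! ### The polynomial bound -/

theorem SmallParameters.two_pow_le {a c w s : ℕ} (h : SmallParameters a n c w s) :
    2 ^ (w + 1 + s) ≤ 2 * (2 * (n + 1)) ^ (2 * a) := by
  have hlog : 2 ^ (Nat.log 2 n + 1) ≤ 2 * (n + 1) := by
    rw [pow_succ, mul_comm]
    refine Nat.mul_le_mul_left 2 ?_
    rcases Nat.eq_zero_or_pos n with rfl | hn
    · simp
    · exact (Nat.pow_log_le_self 2 hn.ne').trans (Nat.le_succ n)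
  calc 2 ^ (w + 1 + s) ≤ 2 ^ (1 + (Nat.log 2 n + 1) * (2 * a)) :=
        Nat.pow_le_pow_right two_pos (by linarith [h.2.1, h.2.2])
    _ = 2 * (2 ^ (Nat.log 2 n + 1)) ^ (2 * a) := by rw [pow_add, pow_one, pow_mul]
    _ ≤ 2 * (2 * (n + 1)) ^ (2 * a) := Nat.mul_le_mul_left 2 (Nat.pow_le_pow_left hlog _)

end Proofdoor

open Polynomial in
theorem mainTheorem3 (a : ℕ) :
    ∃ p : Polynomial ℕ, ∀ (n k c w s : ℕ) (F : Proofdoor.CNF n) (A I : ℕ → Proofdoor.CNF n),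
      Proofdoor.IsProofdoor F k A I c w s → Proofdoor.SmallParameters a n c w s →
      ∃ (T : ℕ) (db : ℕ → Proofdoor.CNF n),
        Proofdoor.IsRefutingRun F T db ∧
        T + 1 ≤ k * p.eval n ∧
        ∀ j, 1 ≤ j → j < k →
          ∃ t ≤ T, t ≤ j * p.eval n ∧ ∀ C ∈ I j, Proofdoor.Absorbs (db t) C := by
  refine ⟨(C a * (X + 1) + 1) * (X * (2 * (2 * (X + 1)) ^ (2 * a)) + 1), ?_⟩
  intro n k c w s F A I h hsmall
  set M := eval n ((C a * (X + 1) + 1) * (X * (2 * (2 * (X + 1)) ^ (2 * a)) + 1)) with hMdef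
  have hN : n * 2 ^ (w + 1 + s) ≤ n * (2 * (2 * (n + 1)) ^ (2 * a)) :=
    Nat.mul_le_mul_left n hsmall.two_pow_le
  have hM : M = (a * (n + 1) + 1) * (n * (2 * (2 * (n + 1)) ^ (2 * a)) + 1) := by
    simp [hMdef]
  have hM₁ : c * (n * 2 ^ (w + 1 + s)) ≤ M := by
    rw [hM]
    exact Nat.mul_le_mul (hsmall.1.trans (Nat.le_succ _)) (hN.trans (Nat.le_succ _))
  have hM₂ : n * 2 ^ (w + 1 + s) + 1 ≤ M := by
    rw [hM]
    exact (Nat.succ_le_succ hN).trans (Nat.le_mul_of_pos_left _ (Nat.succ_pos _))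
  have hk := h.one_le
  obtain ⟨T, db, hrun, hT, hlast, hI⟩ := h.exists_run hM₁ (j := k - 1) (by omega)
  obtain ⟨T', db', hrun', hTT', hT', hdb, -, hempty⟩ := h.attainable_empty T db hrun hlast
  refine ⟨T', db', ⟨hrun'.start, hrun'.step,
    Proofdoor.finalConflict_of_unitConflict (hempty.2 rfl)⟩, ?_, fun j hj hjk => ?_⟩
  · have : k * M = (k - 1) * M + M := by
      rw [← add_one_mul, Nat.sub_add_cancel hk]
    omega
  · obtain ⟨t, ht, htj, hC⟩ := hI j hj (by omega)
    exact ⟨t, ht.trans hTT', htj, by rwa [hdb t ht]⟩
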